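/- Let $l\ge 1$ and let $\{Y_n^{(1)}\}_{n\ge1},\dots,\{Y_n^{(l)}\}_{n\ge1}$ be mutually independent (strictly) stationary sequences of real random variables, regularly varying with tail indices $k_1,\dots,k_l>0$, that is, for each $i$ there is a constant $c^{(i)}>0$ with $P\{Y_n^{(i)}>x\}\sim c^{(i)}x^{-k_i}$ as $x\to\infty$, and having extremal indices $\theta_1,\dots,\theta_l$. Here a stationary sequence $\{R_n\}_{n\ge1}$ with marginal distribution function $F$ is said to have extremal index $\theta\in[0,1]$ if for each $0<\tau<\infty$ there are real numbers $u_n=u_n(\tau)$ such that $n(1-F(u_n))\to\tau$ and $P\{\max_{1\le j\le n}R_j\le u_n\}\to e^{-\tau\theta}$ as $n\to\infty$. Let $z_1,\dots,z_l>0$ and suppose that, for some $m$, $k_m<k_i$ for all $i\ne m$. Then the sequences $$Y_n^*(z)=\max\left(z_1Y_n^{(1)},\dots,z_lY_n^{(l)}\right)\qquad\text{and}\qquad Y_n(z)=z_1Y_n^{(1)}+\dots+z_lY_n^{(l)}$$ are stationary, both have tail index $k_m$ (i.e. their tails are asymptotically equivalent to a positive constant times $x^{-k_m}$), and both have extremal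 index $\theta_m$. -/

import Mathlib

open MeasureTheory ProbabilityTheory Filter Topology Asymptotics

/-- The real random variable `X` has tail index `k > 0`: for some constant `c > 0`,
`P{X > x} ∼ c x^{-k}` as `x → ∞`. -/
def HasTailIndex {Ω : Type*} [MeasurableSpace Ω] (μ : Measure Ω) (X : Ω → ℝ) (k : ℝ) : Prop :=
  0 < k ∧ ∃ c : ℝ, 0 < c ∧
    (fun x : ℝ => μ.real {ω | x < X ω}) ~[atTop] (fun x : ℝ => c * x ^ (-k))

/-- Strict stationarity: the law of the whole sequence is invariant under time shifts. The term of
a sequence written `X j` here is the `(j + 1)`-st term of a sequence numbered from one. -/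
def IsStationarySeq {Ω : Type*} [MeasurableSpace Ω] (μ : Measure Ω) (X : ℕ → Ω → ℝ) : Prop :=
  ∀ h : ℕ, IdentDistrib (fun ω => fun j : ℕ => X (j + h) ω) (fun ω => fun j : ℕ => X j ω) μ μ

/-- The stationary sequence `X` has extremal index `θ ∈ [0, 1]`: for each `τ > 0` there are levels
`u n` with `n (1 - F (u n)) → τ` and `P{M_n ≤ u n} → exp (-τ θ)`. Here `F` is the distribution
function of the terms, and `M_n` is the maximum of the first `n` terms `X 0, …, X (n - 1)`, so that
`{M_n ≤ u}` is the event that each of these terms is at most `u`. -/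
def HasExtremalIndex {Ω : Type*} [MeasurableSpace Ω] (μ : Measure Ω) (X : ℕ → Ω → ℝ) (θ : ℝ) :
    Prop :=
  IsStationarySeq μ X ∧ 0 ≤ θ ∧ θ ≤ 1 ∧
    ∀ τ : ℝ, 0 < τ → ∃ u : ℕ → ℝ,
      Tendsto (fun n : ℕ => (n : ℝ) * μ.real {ω | u n < X 0 ω}) atTop (𝓝 τ) ∧
      Tendsto (fun n : ℕ => μ.real {ω | ∀ j < n, X j ω ≤ u n}) atTop (𝓝 (Real.exp (-τ * θ)))

/-- `Y*_n(z) = max (z_1 Y_n^{(1)}, …, z_l Y_n^{(l)})`. -/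
noncomputable def weightedMax {Ω : Type*} {l : ℕ} [NeZero l] (z : Fin l → ℝ)
    (Y : Fin l → ℕ → Ω → ℝ) (n : ℕ) (ω : Ω) : ℝ :=
  Finset.univ.sup' Finset.univ_nonempty (fun i : Fin l => z i * Y i n ω)

/-- `Y_n(z) = z_1 Y_n^{(1)} + … + z_l Y_n^{(l)}`. -/
noncomputable def weightedSum {Ω : Type*} {l : ℕ} (z : Fin l → ℝ)
    (Y : Fin l → ℕ → Ω → ℝ) (n : ℕ) (ω : Ω) : ℝ :=
  ∑ i : Fin l, z i * Y i n ω

section Tails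

variable {Ω : Type*} [MeasurableSpace Ω] {μ : Measure Ω} {X Z : Ω → ℝ} {k : ℝ}

theorem abs_measureReal_sub_le [IsFiniteMeasure μ] {A B C : Set Ω} (hA : A ⊆ B ∪ C)
    (hB : B ⊆ A ∪ C) : |μ.real A - μ.real B| ≤ μ.real C := by
  have h1 := (measureReal_mono (μ := μ) hA).trans (measureReal_union_le _ _)
  have h2 := (measureReal_mono (μ := μ) hB).trans (measureReal_union_le _ _)
  rw [abs_le]
  constructor <;> linarith

theorem HasTailIndex.eventually_pos (hX : HasTailIndex μ X k) :
    ∀ᶠ x : ℝ in atTop, 0 < μ.real {ω | x < X ω} := by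
  obtain ⟨-, c, hc, h⟩ := hX
  have h1 : ∀ᶠ x : ℝ in atTop, c * x ^ (-k) ≠ 0 := by
    filter_upwards [eventually_gt_atTop 0] with x hx
    positivity
  have h2 := (isEquivalent_iff_tendsto_one h1).1 h
  filter_upwards [h2.eventually (lt_mem_nhds zero_lt_one)] with x hx
  refine lt_of_le_of_ne measureReal_nonneg fun h0 => ?_
  simp [← h0] at hx

theorem HasTailIndex.isEquivalent_scale (hX : HasTailIndex μ X k) :
    ∃ c : ℝ, 0 < c ∧ ∀ a : ℝ, 0 < a →
      (fun x : ℝ => μ.real {ω | a * x < X ω}) ~[atTop] fun x => (c * a ^ (-k)) * x ^ (-k) := by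
  obtain ⟨-, c, hc, h⟩ := hX
  refine ⟨c, hc, fun a ha => ?_⟩
  have h1 := h.comp_tendsto (tendsto_id.const_mul_atTop ha : Tendsto (fun x : ℝ => a * x) atTop atTop)
  refine h1.congr_right ?_
  filter_upwards [eventually_gt_atTop 0] with x hx
  simp only [Function.comp_apply]
  rw [Real.mul_rpow ha.le hx.le, mul_assoc]

theorem HasTailIndex.const_mul (hX : HasTailIndex μ X k) {z : ℝ} (hz : 0 < z) :
    HasTailIndex μ (fun ω => z * X ω) k := by
  obtain ⟨c, hc, h⟩ := hX.isEquivalent_scale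
  refine ⟨hX.1, c * z⁻¹ ^ (-k), by positivity, ?_⟩
  convert h z⁻¹ (inv_pos.2 hz) using 5 with x
  rw [inv_mul_lt_iff₀ hz]

/-- A tail with a tail index varies regularly. -/
theorem HasTailIndex.tendsto_ratio (hX : HasTailIndex μ X k) {a : ℝ} (ha : 0 < a) :
    Tendsto (fun x : ℝ => μ.real {ω | a * x < X ω} / μ.real {ω | x < X ω}) atTop
      (𝓝 (a ^ (-k))) := by
  obtain ⟨c, hc, h⟩ := hX.isEquivalent_scale
  have h1 := (h a ha).div (h 1 one_pos)
  simp only [one_mul, Real.one_rpow, mul_one] at h1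
  refine (h1.symm.tendsto_nhds ?_)
  refine tendsto_const_nhds.congr' ?_
  filter_upwards [eventually_gt_atTop 0] with x hx
  have := (Real.rpow_pos_of_pos hx (-k)).ne'
  simp only [Pi.div_apply]
  field_simp

theorem HasTailIndex.isLittleO_of_lt {W : Ω → ℝ} {k' : ℝ} (hX : HasTailIndex μ X k)
    (hW : HasTailIndex μ W k') (hk : k < k') {a : ℝ} (ha : 0 < a) :
    (fun x : ℝ => μ.real {ω | a * x < W ω}) =o[atTop] fun x => μ.real {ω | x < X ω} := by
  obtain ⟨c, hc, h⟩ := hX.isEquivalent_scale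
  obtain ⟨c', hc', h'⟩ := hW.isEquivalent_scale
  have h1 := h 1 one_pos
  simp only [one_mul, Real.one_rpow, mul_one] at h1
  refine ((h' a ha).isBigO.trans_isLittleO ?_).trans_isBigO h1.symm.isBigO
  have h2 : (fun x : ℝ => x ^ (-k')) =o[atTop] fun x => x ^ (-k) := by
    rw [isLittleO_iff_tendsto' ?_]
    · refine (tendsto_rpow_neg_atTop (sub_pos.2 hk)).congr' ?_
      filter_upwards [eventually_gt_atTop 0] with x hx
      rw [← Real.rpow_sub hx]
      congr 1
      ring
    · filter_upwards [eventually_gt_atTop 0] with x hx h0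
      exact absurd h0 (Real.rpow_pos_of_pos hx _).ne'
  exact (h2.const_mul_left _).const_mul_right hc.ne'

theorem tendsto_measureReal_lt_neg_atTop [IsProbabilityMeasure μ] (hZ : Measurable Z) :
    Tendsto (fun x : ℝ => μ.real {ω | Z ω < -x}) atTop (𝓝 0) := by
  have := Measure.isProbabilityMeasure_map (μ := μ) hZ.aemeasurable
  refine squeeze_zero (fun _ => measureReal_nonneg) (fun x => ?_)
    ((tendsto_cdf_atBot (μ.map Z)).comp tendsto_neg_atTop_atBot)
  simp only [Function.comp_apply]
  rw [cdf_eq_real, map_measureReal_apply hZ measurableSet_Iic]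
  exact measureReal_mono fun ω (hω : Z ω < -x) => hω.le

/-- If `Z` is independent of `X` and its upper tail is negligible with respect to that of `X`, then
`X + Z` and `X` exceed high levels simultaneously, up to a negligible probability. -/
theorem HasTailIndex.isLittleO_exceed_add [IsProbabilityMeasure μ] (hX : HasTailIndex μ X k)
    (hXm : Measurable X) (hZm : Measurable Z) (hXZ : IndepFun X Z μ)
    (hZ : ∀ a : ℝ, 0 < a →
      (fun x : ℝ => μ.real {ω | a * x < Z ω}) =o[atTop] fun x => μ.real {ω | x < X ω}) :
    (fun x : ℝ => μ.real {ω | ¬(x < X ω + Z ω ↔ x < X ω)}) =o[atTop]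
      fun x => μ.real {ω | x < X ω} := by
  rw [isLittleO_iff]
  intro η hη
  obtain ⟨ε, hεη, hε1, hε⟩ : ∃ ε : ℝ, (1 - ε) ^ (-k) - (1 + ε) ^ (-k) < η ∧ ε < 1 ∧ 0 < ε := by
    have hc : Tendsto (fun ε : ℝ => (1 - ε) ^ (-k) - (1 + ε) ^ (-k)) (𝓝[>] 0) (𝓝 0) := by
      have : ContinuousAt (fun ε : ℝ => (1 - ε) ^ (-k) - (1 + ε) ^ (-k)) 0 := by
        refine ContinuousAt.sub ?_ ?_ <;>
          exact ContinuousAt.rpow_const (by fun_prop) (Or.inl (by norm_num))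
      simpa using this.tendsto.mono_left nhdsWithin_le_nhds
    exact ((hc.eventually (gt_mem_nhds hη)).and
      ((eventually_nhdsWithin_of_eventually_nhds (gt_mem_nhds one_pos)).and
        self_mem_nhdsWithin)).exists
  have hlim : Tendsto (fun x : ℝ =>
      μ.real {ω | (1 - ε) * x < X ω} / μ.real {ω | x < X ω}
        - μ.real {ω | (1 + ε) * x < X ω} / μ.real {ω | x < X ω}
        + μ.real {ω | ε * x < Z ω} / μ.real {ω | x < X ω}
        + μ.real {ω | Z ω < -(ε * x)}) atTop
      (𝓝 ((1 - ε) ^ (-k) - (1 + ε) ^ (-k) + 0 + 0)) :=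
    (((hX.tendsto_ratio (by linarith)).sub (hX.tendsto_ratio (by linarith))).add
      (hZ ε hε).tendsto_div_nhds_zero).add
      ((tendsto_measureReal_lt_neg_atTop hZm).comp (tendsto_id.const_mul_atTop hε))
  rw [add_zero, add_zero] at hlim
  filter_upwards [hlim.eventually (gt_mem_nhds hεη), hX.eventually_pos, eventually_gt_atTop 0]
    with x hx hpos hx0
  rw [Real.norm_of_nonneg measureReal_nonneg, Real.norm_of_nonneg measureReal_nonneg]
  have hind : μ.real ({ω | x < X ω} ∩ {ω | Z ω < -(ε * x)})
      = μ.real {ω | x < X ω} * μ.real {ω | Z ω < -(ε * x)} := by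
    have := hXZ.measure_inter_preimage_eq_mul (Set.Ioi x) (Set.Iio (-(ε * x)))
      measurableSet_Ioi measurableSet_Iio
    exact (congrArg ENNReal.toReal this).trans ENNReal.toReal_mul
  have hdiff : μ.real ({ω | (1 - ε) * x < X ω} \ {ω | (1 + ε) * x < X ω})
      = μ.real {ω | (1 - ε) * x < X ω} - μ.real {ω | (1 + ε) * x < X ω} := by
    refine measureReal_sdiff (fun ω hω => ?_) (measurableSet_lt measurable_const hXm)
    have h : (1 + ε) * x < X ω := hω
    show (1 - ε) * x < X ω
    nlinarith
  have hsub : {ω | ¬(x < X ω + Z ω ↔ x < X ω)} ⊆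
      (({ω | (1 - ε) * x < X ω} \ {ω | (1 + ε) * x < X ω}) ∪ {ω | ε * x < Z ω}) ∪
        ({ω | x < X ω} ∩ {ω | Z ω < -(ε * x)}) := by
    intro ω hω
    simp only [Set.mem_union, Set.mem_sdiff, Set.mem_inter_iff, Set.mem_ofPred_eq] at hω ⊢
    by_contra! hcon
    obtain ⟨⟨h1, h2⟩, h3⟩ := hcon
    refine hω ⟨fun h => ?_, fun h => ?_⟩
    · by_contra! h4
      nlinarith [h1 (by nlinarith)]
    · nlinarith [h1 (by nlinarith), h3 h]
  have hle : μ.real {ω | ¬(x < X ω + Z ω ↔ x < X ω)} ≤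
      μ.real {ω | (1 - ε) * x < X ω} - μ.real {ω | (1 + ε) * x < X ω}
        + μ.real {ω | ε * x < Z ω} + μ.real {ω | x < X ω} * μ.real {ω | Z ω < -(ε * x)} := by
    rw [← hind, ← hdiff]
    exact (measureReal_mono hsub).trans ((measureReal_union_le _ _).trans
      (add_le_add_left (measureReal_union_le _ _) _))
  refine hle.trans ?_
  have := mul_le_mul_of_nonneg_right hx.le hpos.le
  convert this using 1
  field_simp

/-- The tail index is inherited by random variables that exceed high levels simultaneously with `X`,
up to a negligible probability. -/
theorem HasTailIndex.of_isLittleO_exceed [IsProbabilityMeasure μ] {S : Ω → ℝ}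
    (hX : HasTailIndex μ X k)
    (hS : (fun x : ℝ => μ.real {ω | ¬(x < S ω ↔ x < X ω)}) =o[atTop]
      fun x => μ.real {ω | x < X ω}) :
    HasTailIndex μ S k := by
  obtain ⟨hk, c, hc, h⟩ := hX
  refine ⟨hk, c, hc, IsEquivalent.trans ?_ h⟩
  refine IsLittleO.isEquivalent (IsBigO.trans_isLittleO (IsBigO.of_bound 1 ?_) hS)
  refine .of_forall fun x => ?_
  rw [one_mul, Real.norm_of_nonneg measureReal_nonneg, Real.norm_eq_abs, Pi.sub_apply]
  refine abs_measureReal_sub_le (fun ω (hω : x < S ω) => ?_) (fun ω (hω : x < X ω) => ?_)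
  · exact or_iff_not_imp_left.2 fun hx h => hx (h.1 hω)
  · exact or_iff_not_imp_left.2 fun hx h => hx (h.2 hω)

end Tails

section Extremes

variable {Ω : Type*} [MeasurableSpace Ω] {μ : Measure Ω} {X S : ℕ → Ω → ℝ} {k θ : ℝ}

theorem IsStationarySeq.comp {E : Type*} [MeasurableSpace E] {V : ℕ → Ω → E} {g : E → ℝ}
    (hV : ∀ h : ℕ, IdentDistrib (fun ω (j : ℕ) => V (j + h) ω) (fun ω (j : ℕ) => V j ω) μ μ)
    (hg : Measurable g) : IsStationarySeq μ fun j ω => g (V j ω) := fun h =>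
  (hV h).comp (u := fun (v : ℕ → E) (j : ℕ) => g (v j)) (by fun_prop)

theorem HasExtremalIndex.const_mul (hX : HasExtremalIndex μ X θ) {z : ℝ} (hz : 0 < z) :
    HasExtremalIndex μ (fun j ω => z * X j ω) θ := by
  obtain ⟨hs, h0, h1, h⟩ := hX
  refine ⟨IsStationarySeq.comp (g := fun x => z * x) hs (measurable_const_mul z), h0, h1,
    fun τ hτ => ?_⟩
  obtain ⟨u, hu, hM⟩ := h τ hτ
  exact ⟨fun n => z * u n, by simpa [mul_lt_mul_iff_right₀ hz] using hu,
    by simpa [mul_le_mul_iff_right₀ hz] using hM⟩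

theorem tendsto_atTop_of_tail [IsFiniteMeasure μ] {X : Ω → ℝ} (hX : HasTailIndex μ X k)
    {u : ℕ → ℝ} {τ : ℝ}
    (hu : Tendsto (fun n : ℕ => (n : ℝ) * μ.real {ω | u n < X ω}) atTop (𝓝 τ)) :
    Tendsto u atTop atTop := by
  have h0 : Tendsto (fun n : ℕ => μ.real {ω | u n < X ω}) atTop (𝓝 0) := by
    have := hu.mul (tendsto_inv_atTop_nhds_zero_nat (𝕜 := ℝ))
    rw [mul_zero] at this
    refine this.congr' ?_
    filter_upwards [eventually_gt_atTop 0] with n hn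
    have : (n : ℝ) ≠ 0 := by positivity
    field_simp
  rw [tendsto_atTop]
  intro b
  obtain ⟨x, hx, hbx⟩ := (hX.eventually_pos.and (eventually_ge_atTop b)).exists
  filter_upwards [h0.eventually (gt_mem_nhds hx)] with n hn
  by_contra! h
  exact absurd hn (not_lt.2 (measureReal_mono fun ω (hω : x < X ω) => by
    show u n < X ω
    linarith))

/-- Two sequences whose exceedances of high levels coincide, up to a probability negligible with
respect to the tail, have the same extremal index. -/
theorem HasExtremalIndex.of_isLittleO_exceed [IsProbabilityMeasure μ]
    (hX : HasExtremalIndex μ X θ) (ht : HasTailIndex μ (X 0) k) (hS : IsStationarySeq μ S)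
    (hD : ∀ (j : ℕ) (x : ℝ), μ.real {ω | ¬(x < S j ω ↔ x < X j ω)}
      = μ.real {ω | ¬(x < S 0 ω ↔ x < X 0 ω)})
    (ho : (fun x : ℝ => μ.real {ω | ¬(x < S 0 ω ↔ x < X 0 ω)}) =o[atTop]
      fun x => μ.real {ω | x < X 0 ω}) :
    HasExtremalIndex μ S θ := by
  obtain ⟨-, h0, h1, h⟩ := hX
  refine ⟨hS, h0, h1, fun τ hτ => ?_⟩
  obtain ⟨u, hu, hM⟩ := h τ hτ
  have hutop := tendsto_atTop_of_tail ht hu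
  have hnD : Tendsto (fun n : ℕ => (n : ℝ) * μ.real {ω | ¬(u n < S 0 ω ↔ u n < X 0 ω)}) atTop
      (𝓝 0) := by
    have := (((isBigO_refl (fun n : ℕ => (n : ℝ)) atTop).mul_isLittleO
      (ho.comp_tendsto hutop)).trans_isBigO (hu.isBigO_one ℝ)).tendsto_div_nhds_zero
    simpa using this
  refine ⟨u, ?_, ?_⟩
  · refine tendsto_of_tendsto_of_dist hu (squeeze_zero (fun _ => dist_nonneg) (fun n => ?_) hnD)
    rw [Real.dist_eq, ← mul_sub, abs_mul, Nat.abs_cast]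
    refine mul_le_mul_of_nonneg_left (abs_measureReal_sub_le (fun ω (hω : u n < X 0 ω) => ?_)
      fun ω (hω : u n < S 0 ω) => ?_) n.cast_nonneg
    · exact or_iff_not_imp_left.2 fun hx h => hx (h.2 hω)
    · exact or_iff_not_imp_left.2 fun hx h => hx (h.1 hω)
  · refine tendsto_of_tendsto_of_dist hM (squeeze_zero (fun _ => dist_nonneg) (fun n => ?_) hnD)
    have hU : μ.real (⋃ j ∈ Finset.range n, {ω | ¬(u n < S j ω ↔ u n < X j ω)}) ≤
        n * μ.real {ω | ¬(u n < S 0 ω ↔ u n < X 0 ω)} := by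
      refine (measureReal_biUnion_finset_le _ _).trans_eq ?_
      simp [hD]
    refine le_trans (abs_measureReal_sub_le (fun ω (hω : ∀ j < n, X j ω ≤ u n) => ?_)
      fun ω (hω : ∀ j < n, S j ω ≤ u n) => ?_) hU
    · refine or_iff_not_imp_right.2 fun hx j hj => ?_
      simp only [Set.mem_iUnion, Finset.mem_range, not_exists] at hx
      have := not_not.1 (hx j hj)
      exact not_lt.1 fun h => (hω j hj).not_gt (this.1 h)
    · refine or_iff_not_imp_right.2 fun hx j hj => ?_
      simp only [Set.mem_iUnion, Finset.mem_range, not_exists] at hx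
      have := not_not.1 (hx j hj)
      exact not_lt.1 fun h => (hω j hj).not_gt (this.2 h)

/-- Mutually independent stationary sequences are jointly stationary. -/
theorem ProbabilityTheory.iIndepFun.identDistrib_shift [IsProbabilityMeasure μ] {ι : Type*}
    [Fintype ι] {Y : ι → ℕ → Ω → ℝ} (hmeas : ∀ i n, Measurable (Y i n))
    (hindep : iIndepFun (fun i ω n => Y i n ω) μ) (hs : ∀ i, IsStationarySeq μ (Y i)) (h : ℕ) :
    IdentDistrib (fun ω (j : ℕ) (i : ι) => Y i (j + h) ω) (fun ω (j : ℕ) (i : ι) => Y i j ω)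
      μ μ := by
  have hind' : iIndepFun (fun i ω n => Y i (n + h) ω) μ :=
    hindep.comp (fun _ v n => v (n + h)) fun _ => by fun_prop
  have key : IdentDistrib (fun ω (i : ι) (j : ℕ) => Y i (j + h) ω)
      (fun ω (i : ι) (j : ℕ) => Y i j ω) μ μ := by
    refine ⟨by fun_prop, by fun_prop, ?_⟩
    rw [(iIndepFun_iff_map_fun_eq_pi_map (fun i => by fun_prop)).1 hindep,
      (iIndepFun_iff_map_fun_eq_pi_map (fun i => by fun_prop)).1 hind']
    exact congrArg _ (funext fun i => (hs i h).map_eq)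
  exact key.comp (u := fun v (j : ℕ) (i : ι) => v i j) (by fun_prop)

theorem HasExtremalIndex.of_functional [IsProbabilityMeasure μ] {ι : Type*} [Fintype ι]
    {Y : ι → ℕ → Ω → ℝ} (hmeas : ∀ i n, Measurable (Y i n))
    (hindep : iIndepFun (fun i ω n => Y i n ω) μ) (hs : ∀ i, IsStationarySeq μ (Y i))
    {f g : (ι → ℝ) → ℝ} (hf : Measurable f) (hg : Measurable g)
    (hX : HasExtremalIndex μ (fun j ω => f fun i => Y i j ω) θ)
    (ht : HasTailIndex μ (fun ω => f fun i => Y i 0 ω) k)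
    (ho : (fun x : ℝ => μ.real {ω | ¬(x < g (fun i => Y i 0 ω) ↔ x < f fun i => Y i 0 ω)})
      =o[atTop] fun x => μ.real {ω | x < f fun i => Y i 0 ω}) :
    HasExtremalIndex μ (fun j ω => g fun i => Y i j ω) θ := by
  have hV := hindep.identDistrib_shift hmeas hs
  refine hX.of_isLittleO_exceed ht
    (IsStationarySeq.comp (V := fun j ω i => Y i j ω) hV hg) (fun j x => ?_) ho
  have h0 : IdentDistrib (fun ω i => Y i j ω) (fun ω i => Y i 0 ω) μ μ := by
    simpa [Function.comp_def] using (hV j).comp (measurable_pi_apply 0)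
  have hset : MeasurableSet {v : ι → ℝ | ¬(x < g v ↔ x < f v)} :=
    ((measurableSet_lt measurable_const hg).iff (measurableSet_lt measurable_const hf)).compl
  exact congrArg ENNReal.toReal (h0.measure_mem_eq hset)

end Extremes

section Combination

variable {Ω : Type*} [MeasurableSpace Ω] {μ : Measure Ω} {l : ℕ}

theorem isLittleO_exceed_weightedMax [IsProbabilityMeasure μ] [NeZero l] {Y : Fin l → ℕ → Ω → ℝ}
    {k z : Fin l → ℝ} {m : Fin l} (n : ℕ) (htail : ∀ i, HasTailIndex μ (Y i n) (k i))
    (hz : ∀ i, 0 < z i) (hmin : ∀ i, i ≠ m → k m < k i) :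
    (fun x : ℝ => μ.real {ω | ¬(x < weightedMax z Y n ω ↔ x < z m * Y m n ω)}) =o[atTop]
      fun x => μ.real {ω | x < z m * Y m n ω} := by
  have ho : (fun x : ℝ => ∑ i ∈ Finset.univ.erase m, μ.real {ω | x < z i * Y i n ω}) =o[atTop]
      fun x => μ.real {ω | x < z m * Y m n ω} := by
    refine IsLittleO.fun_sum fun i hi => ?_
    simpa using ((htail m).const_mul (hz m)).isLittleO_of_lt ((htail i).const_mul (hz i))
      (hmin i (Finset.ne_of_mem_erase hi)) one_pos
  refine IsBigO.trans_isLittleO (IsBigO.of_bound 1 (.of_forall fun x => ?_)) ho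
  rw [one_mul, Real.norm_of_nonneg measureReal_nonneg]
  refine le_trans ?_ (le_abs_self _)
  refine le_trans (measureReal_mono ?_ (measure_ne_top _ _)) (measureReal_biUnion_finset_le _ _)
  intro ω hω
  simp only [weightedMax, Finset.lt_sup'_iff, Finset.mem_univ, true_and, Set.mem_ofPred_eq] at hω
  simp only [Set.mem_iUnion, Finset.mem_erase, Finset.mem_univ, and_true, Set.mem_ofPred_eq]
  by_contra! hcon
  refine hω ⟨?_, fun h => ⟨m, h⟩⟩
  rintro ⟨i, hi⟩
  by_cases him : i = m
  · exact him ▸ hi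
  · exact absurd hi (hcon i him).not_gt

theorem isLittleO_exceed_weightedSum [IsProbabilityMeasure μ] {Y : Fin l → ℕ → Ω → ℝ}
    {k z : Fin l → ℝ} {m : Fin l} (n : ℕ) (hmeas : ∀ i n, Measurable (Y i n))
    (hindep : iIndepFun (fun i ω n => Y i n ω) μ) (htail : ∀ i, HasTailIndex μ (Y i n) (k i))
    (hz : ∀ i, 0 < z i) (hmin : ∀ i, i ≠ m → k m < k i) :
    (fun x : ℝ => μ.real {ω | ¬(x < weightedSum z Y n ω ↔ x < z m * Y m n ω)}) =o[atTop]
      fun x => μ.real {ω | x < z m * Y m n ω} := by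
  have hind : IndepFun (fun ω => z m * Y m n ω)
      (fun ω => ∑ i ∈ Finset.univ.erase m, z i * Y i n ω) μ := by
    have h1 : iIndepFun (fun i ω => z i * Y i n ω) μ :=
      hindep.comp (fun i v => z i * v n) fun i => by fun_prop
    have h2 := h1.indepFun_finsetSum_of_notMem (fun i => by fun_prop)
      (Finset.notMem_erase m Finset.univ)
    convert h2.symm using 1
    ext ω
    simp
  have hsum : ∀ ω, weightedSum z Y n ω
      = z m * Y m n ω + ∑ i ∈ Finset.univ.erase m, z i * Y i n ω := fun ω =>
    (Finset.add_sum_erase _ (fun i => z i * Y i n ω) (Finset.mem_univ m)).symm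
  simp only [hsum]
  refine ((htail m).const_mul (hz m)).isLittleO_exceed_add (by fun_prop) (by fun_prop) hind
    fun a ha => ?_
  have hl : (0 : ℝ) < l := by exact_mod_cast m.pos
  have ho : (fun x : ℝ => ∑ i ∈ Finset.univ.erase m, μ.real {ω | a / l * x < z i * Y i n ω})
      =o[atTop] fun x => μ.real {ω | x < z m * Y m n ω} :=
    IsLittleO.fun_sum fun i hi => ((htail m).const_mul (hz m)).isLittleO_of_lt
      ((htail i).const_mul (hz i)) (hmin i (Finset.ne_of_mem_erase hi)) (by positivity)
  refine IsBigO.trans_isLittleO (IsBigO.of_bound 1 ?_) ho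
  filter_upwards [eventually_gt_atTop 0] with x hx
  rw [one_mul, Real.norm_of_nonneg measureReal_nonneg]
  refine le_trans ?_ (le_abs_self _)
  refine le_trans (measureReal_mono ?_ (measure_ne_top _ _)) (measureReal_biUnion_finset_le _ _)
  intro ω (hω : a * x < _)
  simp only [Set.mem_iUnion, Set.mem_ofPred_eq, exists_prop]
  by_contra! hcon
  have h1 := Finset.sum_le_card_nsmul _ _ _ hcon
  have h2 : ((Finset.univ.erase m).card : ℝ) ≤ l := by
    exact_mod_cast (Finset.card_le_univ _).trans_eq (Fintype.card_fin l)
  have h3 : (l : ℝ) * (a / l * x) = a * x := by field_simp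
  rw [nsmul_eq_mul] at h1
  have h4 := mul_le_mul_of_nonneg_right h2 (by positivity : 0 ≤ a / l * x)
  linarith

end Combination

theorem theorem3 {Ω : Type*} [MeasurableSpace Ω] (μ : Measure Ω) [IsProbabilityMeasure μ]
    {l : ℕ} [NeZero l] (Y : Fin l → ℕ → Ω → ℝ) (k θ z : Fin l → ℝ) (m : Fin l)
    (hmeas : ∀ i n, Measurable (Y i n))
    (hindep : iIndepFun (fun (i : Fin l) (ω : Ω) (n : ℕ) => Y i n ω) μ)
    (htail : ∀ i n, HasTailIndex μ (Y i n) (k i))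
    (hext : ∀ i, HasExtremalIndex μ (Y i) (θ i))
    (hz : ∀ i, 0 < z i)
    (hmin : ∀ i, i ≠ m → k m < k i) :
    (∀ n, HasTailIndex μ (weightedMax z Y n) (k m)) ∧
    (∀ n, HasTailIndex μ (weightedSum z Y n) (k m)) ∧
    HasExtremalIndex μ (weightedMax z Y) (θ m) ∧
    HasExtremalIndex μ (weightedSum z Y) (θ m) := by
  have hs : ∀ i, IsStationarySeq μ (Y i) := fun i => (hext i).1
  have hX : ∀ n, HasTailIndex μ (fun ω => z m * Y m n ω) (k m) := fun n =>
    (htail m n).const_mul (hz m)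
  have hmax := fun n => isLittleO_exceed_weightedMax n (fun i => htail i n) hz hmin
  have hsum := fun n => isLittleO_exceed_weightedSum n hmeas hindep (fun i => htail i n) hz hmin
  have hθ := (hext m).const_mul (hz m)
  have hf : Measurable fun v : Fin l → ℝ => z m * v m := by fun_prop
  refine ⟨fun n => (hX n).of_isLittleO_exceed (hmax n),
    fun n => (hX n).of_isLittleO_exceed (hsum n), ?_, ?_⟩
  · refine HasExtremalIndex.of_functional hmeas hindep hs hf
      (g := fun v => Finset.univ.sup' Finset.univ_nonempty fun i => z i * v i) ?_ hθ (hX 0) (hmax 0)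
    convert Finset.measurable_sup' (f := fun i (v : Fin l → ℝ) => z i * v i)
      Finset.univ_nonempty fun i _ => by fun_prop using 1
    ext v
    rw [Finset.sup'_apply]
  · exact HasExtremalIndex.of_functional hmeas hindep hs hf
      (g := fun v => ∑ i, z i * v i) (by fun_prop) hθ (hX 0) (hsum 0)
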